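/- Let $\mathbb F$ be the field with two elements and let $K$ be a knot in $S^3$. Write $\widehat{HFK}_m(K,a)$ for its knot Floer homology over $\mathbb F$ in Maslov grading $m$ and Alexander grading $a$, and let the thickness of $K$ be $$th(K)=\max\{\,|(m-a)-(m'-a')| \;:\; \widehat{HFK}_m(K,a)\neq 0,\ \widehat{HFK}_{m'}(K,a')\neq 0\,\}.$$ Suppose that $th(K)\le 2$ and that for every $a\in\mathbb Z$ there are at most two integers $m$ with $\widehat{HFK}_m(K,a)\ne 0$. Let $(C,d)$ be a reduced representative of the full knot Floer complex $CFK_{\mathbb F[u,v]}(K)$: a bigraded chain complex, free over $\mathbb F[u,v]$ on homogeneous generators $x_0,\dots,x_{n-1}$ with Maslov gradings $M(x_i)$ and Alexander gradings $A(x_i)$, bigraded chain homotopy equivalent over $\mathbb F[u,v]$ to $CFK_{\mathbb F[u,v]}(K)$, such that all coefficients of $d$ lie in the ideal $(u,v)$. Here $u$ and $v$ have (Maslov, Alexander) bidegrees $(-2,-1)$ and $(0,1)$, and $d$ has bidegree $(-1,0)$. (The complex $CFK_{\mathbb F[u,v]}(K)$, and $\widehat{HFK}(K)=H_*(CFK_{\mathbb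 F[u,v]}(K)/(u,v))$, may be computed from the grid complex of any grid diagram of $K$.) Let $H$ and $V$ be the $n\times n$ matrices over $\mathbb F[U]$ of the horizontal and vertical arrows of $d$: if $u^k x_i$ (respectively $v^l x_i$) occurs in $d x_j$, then the $(i,j)$ entry of $H$ is $U^k$ (respectively that of $V$ is $U^0=1$), and the other entries are $0$. Say that $(i,j)$ is admissible if $$k_{i,j}=\tfrac12\bigl(M(x_i)-M(x_j)+1\bigr)$$ is an integer with $k_{i,j}\ge 1$ and $k_{i,j}>A(x_i)-A(x_j)$. Introduce an unknown $a_{i,j}$ for each admissible pair, let $D_{var}$ be the $n\times n$ matrix whose $(i,j)$ entry is $U^{k_{i,j}}a_{i,j}$ if $(i,j)$ is admissible and $0$ otherwise, and put $d_{var}=H+V+D_{var}$, a matrix over $\mathbb F[U][\{a_{i,j}\}]$. Then: 1. $D_{var}^2=0$. 2. Every entry of $d_{var}^2$ is a polynomial of total degree at most one in the unknowns $a_{i,j}$ over $\mathbb F[U]$. 3. Consequently, the equation $d_{var}^2=0$ for values $a=(a_{i,j})$ in $\mathbb F$ is a linear system over $\mathbb F$: $d_{var}(a)^2=0$ if and only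 if $Aa=b$, where the row of the matrix $A$ indexed by $(k,l,r)$ consists of the coefficients of the unknowns $a_{i,j}$ in the coefficient of $U^r$ in the $(k,l)$ entry of $d_{var}^2$, and the corresponding entry of $b$ is the constant term of that coefficient. -/

import Mathlib

open MvPolynomial

namespace KnotFloer

noncomputable section

/-- The field `𝔽` with two elements. -/
abbrev F2 : Type := ZMod 2

/-- The polynomial ring `𝔽[U_t (t : τ), v]`: the variable `some t` is `U_t` and `none` is `v`.
For `τ = Unit` this is `𝔽[u, v]`. -/
abbrev Coeff (τ : Type) : Type := MvPolynomial (Option τ) F2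

/-- The (Maslov, Alexander) bidegrees of the variables: each `U_t` has bidegree `(-2, -1)`
and `v` has bidegree `(0, 1)`. -/
def varDegree (τ : Type) : Option τ → ℤ × ℤ
  | some _ => (-2, -1)
  | none => (0, 1)

/-- The data of a complex that is free on a finite set `ι` of bigraded generators over
`𝔽[U_t (t : τ), v]`. It is regarded as a complex over `𝔽[u, v]` by letting `u` act as `U_base`.
As usual, the column `j` of `diff` holds the differential of the generator `j`:
`d x_j = ∑ i, diff i j • x_i`. -/
structure FreeComplex (ι τ : Type) where
  base : τ
  maslov : ι → ℤ
  alexander : ι → ℤ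
  diff : Matrix ι ι (Coeff τ)

namespace FreeComplex

variable {ι τ : Type} [Fintype ι]

/-- The underlying free module. -/
abbrev Chain (_C : FreeComplex ι τ) : Type := ι → Coeff τ

/-- The element of the coefficient ring by which `u` acts. -/
def u (C : FreeComplex ι τ) : Coeff τ := X (some C.base)

/-- The element of the coefficient ring by which `v` acts. -/
def v (_C : FreeComplex ι τ) : Coeff τ := X none

/-- The differential as a linear map. -/
def d (C : FreeComplex ι τ) : C.Chain →ₗ[Coeff τ] C.Chain := Matrix.mulVecLin C.diff

/-- The chains of Maslov grading `m` and Alexander grading `a`. -/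
def part (C : FreeComplex ι τ) (m a : ℤ) : Submodule F2 C.Chain :=
  Submodule.pi Set.univ fun s =>
    weightedHomogeneousSubmodule F2 (varDegree τ) (m - C.maslov s, a - C.alexander s)

/-- The submodule `(u, v) · C`. -/
def uvSub (C : FreeComplex ι τ) : Submodule (Coeff τ) C.Chain :=
  Ideal.span {C.u, C.v} • (⊤ : Submodule (Coeff τ) C.Chain)

theorem uvSub_le_comap (C : FreeComplex ι τ) : C.uvSub ≤ C.uvSub.comap C.d := by
  rw [← Submodule.map_le_iff_le_comap, uvSub, Submodule.map_smul'']
  exact Submodule.smul_mono le_rfl le_top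

/-- The differential of `C / (u, v)`. -/
def hatDiff (C : FreeComplex ι τ) : (C.Chain ⧸ C.uvSub) →ₗ[F2] (C.Chain ⧸ C.uvSub) :=
  (C.uvSub.mapQ C.uvSub C.d C.uvSub_le_comap).restrictScalars F2

/-- The part of `C / (u, v)` of Maslov grading `m` and Alexander grading `a`. -/
def hatPart (C : FreeComplex ι τ) (m a : ℤ) : Submodule F2 (C.Chain ⧸ C.uvSub) :=
  (C.part m a).map (C.uvSub.mkQ.restrictScalars F2)

/-- The cycles of `C / (u, v)` in bidegree `(m, a)`. -/
def hatCycles (C : FreeComplex ι τ) (m a : ℤ) : Submodule F2 (C.Chain ⧸ C.uvSub) :=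
  C.hatPart m a ⊓ LinearMap.ker C.hatDiff

/-- The boundaries of `C / (u, v)` in bidegree `(m, a)`; the differential has bidegree
`(-1, 0)`. -/
def hatBoundaries (C : FreeComplex ι τ) (m a : ℤ) : Submodule F2 (C.Chain ⧸ C.uvSub) :=
  (C.hatPart (m + 1) a).map C.hatDiff

/-- The homology of `C / (u, v)` in Maslov grading `m` and Alexander grading `a`. -/
abbrev HatHomology (C : FreeComplex ι τ) (m a : ℤ) : Type :=
  C.hatCycles m a ⧸ (C.hatBoundaries m a).submoduleOf (C.hatCycles m a)

/-- An `𝔽`-linear map between the underlying modules that is linear over `𝔽[u, v]`. -/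
def IsUVLinear {ι' τ' : Type} [Fintype ι']
    (C : FreeComplex ι τ) (C' : FreeComplex ι' τ')
    (f : C.Chain →ₗ[F2] C'.Chain) : Prop :=
  ∀ z, f (C.u • z) = C'.u • f z ∧ f (C.v • z) = C'.v • f z

/-- A map that raises the Maslov grading by `p` and preserves the Alexander grading. -/
def HasDegree {ι' τ' : Type} [Fintype ι']
    (C : FreeComplex ι τ) (C' : FreeComplex ι' τ')
    (f : C.Chain →ₗ[F2] C'.Chain) (p : ℤ) : Prop :=
  ∀ m a, ∀ z ∈ C.part m a, f z ∈ C'.part (m + p) a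

/-- Bigraded chain homotopy equivalence over `𝔽[u, v]`. -/
def HomotopyEquivalent {ι' τ' : Type} [Fintype ι']
    (C : FreeComplex ι τ) (C' : FreeComplex ι' τ') : Prop :=
  ∃ (f : C.Chain →ₗ[F2] C'.Chain) (g : C'.Chain →ₗ[F2] C.Chain)
    (h : C.Chain →ₗ[F2] C.Chain) (h' : C'.Chain →ₗ[F2] C'.Chain),
    (C.IsUVLinear C' f ∧ C.HasDegree C' f 0) ∧
    (C'.IsUVLinear C g ∧ C'.HasDegree C g 0) ∧
    (C.IsUVLinear C h ∧ C.HasDegree C h 1) ∧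
    (C'.IsUVLinear C' h' ∧ C'.HasDegree C' h' 1) ∧
    (∀ z, f (C.d z) = C'.d (f z)) ∧
    (∀ z, g (C'.d z) = C.d (g z)) ∧
    (∀ z, g (f z) - z = C.d (h z) + h (C.d z)) ∧
    (∀ z, f (g z) - z = C'.d (h' z) + h' (C'.d z))

/-- A reduced bigraded chain complex: the differential squares to zero, has bidegree `(-1, 0)`,
and its coefficients lie in the maximal ideal generated by the variables. -/
structure IsReducedComplex (C : FreeComplex ι τ) : Prop where
  d_sq : C.diff * C.diff = 0
  degree : ∀ i j, IsWeightedHomogeneous (varDegree τ) (C.diff i j)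
    (C.maslov j - 1 - C.maslov i, C.alexander j - C.alexander i)
  reduced : ∀ i j, constantCoeff (C.diff i j) = 0

end FreeComplex

/-- A toroidal grid diagram of size `N` of a knot. The column `c` has its `O`-marking in row `O c`
and its `X`-marking in row `X c`. The diagram has a single component when the permutation that
follows the knot from column to column is one cycle through all the columns. -/
structure KnotGrid (N : ℕ) where
  O : Equiv.Perm (Fin N)
  X : Equiv.Perm (Fin N)
  ne : ∀ c, O c ≠ X c
  knot : (O⁻¹ * X).IsCycle

namespace KnotGrid

variable {N : ℕ}

/-- A grid state: the column circle `c` carries a point on the row circle `x c`. The marking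
`O c` sits in the centre of the unit square whose lower left corner is `(c, O c)`. -/
abbrev State (N : ℕ) : Type := Equiv.Perm (Fin N)

/-- The Maslov grading of a state relative to markings `P`:
`I(x,x) - I(x,P) - I(P,x) + I(P,P) + 1`, where `I(A,B)` is the number of pairs `(a,b)` in `A × B`
such that `a` is strictly below and strictly to the left of `b`. -/
def maslovRel (P : Equiv.Perm (Fin N)) (x : State N) : ℤ :=
  (Finset.univ.filter fun p : Fin N × Fin N => p.1 < p.2 ∧ x p.1 < x p.2).card
    - (Finset.univ.filter fun p : Fin N × Fin N => p.1 ≤ p.2 ∧ x p.1 ≤ P p.2).card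
    - (Finset.univ.filter fun p : Fin N × Fin N => p.1 < p.2 ∧ P p.1 < x p.2).card
    + (Finset.univ.filter fun p : Fin N × Fin N => p.1 < p.2 ∧ P p.1 < P p.2).card + 1

/-- The Maslov grading of a grid state. -/
def maslov (G : KnotGrid N) (x : State N) : ℤ := maslovRel G.O x

/-- The Alexander grading `(M_O(x) - M_X(x) - (N - 1)) / 2` of a grid state; for a knot the
numerator is even. -/
def alexander (G : KnotGrid N) (x : State N) : ℤ :=
  (maslovRel G.O x - maslovRel G.X x - ((N : ℤ) - 1)) / 2

/-- For `i ≠ j` the pair `(i, j)` gives the rectangle in the torus with lower left corner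
`(i, x i)` and upper right corner `(j, x j)`. It goes from `x` to the state `x * swap i j`. This is
the condition that it contains the unit square with lower left corner `(c, r)`. -/
def InRect (x : State N) (i j c r : Fin N) : Prop :=
  c - i < j - i ∧ r - x i < x j - x i

/-- The rectangle has no point of `x` in its interior. -/
def IsEmptyRect (x : State N) (i j : Fin N) : Prop :=
  ∀ k, k ≠ i → k ≠ j → ¬ InRect x i j k (x k)

open Classical in
/-- The weight `∏ U_c ^ {O_c ∈ r} · v ^ #(X ∩ r)` of a rectangle `r`. -/
def rectWeight (G : KnotGrid N) (x : State N) (i j : Fin N) : Coeff (Fin N) :=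
  (∏ c, if InRect x i j c (G.O c) then MvPolynomial.X (some c) else 1) *
    ∏ c, if InRect x i j c (G.X c) then MvPolynomial.X none else 1

open Classical in
/-- The full grid complex over `𝔽[U_0, …, U_{N-1}, v]`: the differential of `x` is the sum over
all empty rectangles from `x` of the weight times the terminal state. The variable `u` acts as
`U_0`. -/
def complex (G : KnotGrid N) [NeZero N] : FreeComplex (State N) (Fin N) where
  base := 0
  maslov := G.maslov
  alexander := G.alexander
  diff := fun y x => ∑ p : Fin N × Fin N,
    if p.1 ≠ p.2 ∧ IsEmptyRect x p.1 p.2 ∧ y = x * Equiv.swap p.1 p.2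
      then G.rectWeight x p.1 p.2 else 0

/-- The knot Floer homology `HFK_m(K, a)` (hat version) over `𝔽`. -/
abbrev HFK (G : KnotGrid N) [NeZero N] (m a : ℤ) : Type := G.complex.HatHomology m a

/-- The pairs `(m, a)` such that `HFK_m(K, a) ≠ 0`. -/
def hfkSupport (G : KnotGrid N) [NeZero N] : Set (ℤ × ℤ) :=
  {p | Nontrivial (G.HFK p.1 p.2)}

/-- The thickness: the largest value of `|(M(x) - A(x)) - (M(y) - A(y))|` over the homogeneous
generators `x, y` of knot Floer homology. -/
def thickness (G : KnotGrid N) [NeZero N] : ℕ∞ :=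
  ⨆ (p ∈ G.hfkSupport) (q ∈ G.hfkSupport), (((p.1 - p.2) - (q.1 - q.2)).natAbs : ℕ∞)

/-- `C` is a reduced representative, with generators `x_0, …, x_{n-1}`, of the full knot Floer
complex over `𝔽[u, v]` of the knot with grid diagram `G`. -/
def IsReducedRepresentative (G : KnotGrid N) [NeZero N] {n : ℕ}
    (C : FreeComplex (Fin n) Unit) : Prop :=
  C.IsReducedComplex ∧ C.HomotopyEquivalent G.complex

end KnotGrid

section Placeholder

variable {n : ℕ}

/-- The matrix over `𝔽[U]` of the horizontal arrows of `C`: the terms `u ^ k` (with no `v`) in the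
coefficients of the differential, written as `U ^ k`. -/
def horizontal (C : FreeComplex (Fin n) Unit) : Matrix (Fin n) (Fin n) (Polynomial F2) :=
  C.diff.map (aeval fun t : Option Unit => t.elim 0 fun _ => Polynomial.X)

/-- The matrix over `𝔽[U]` of the vertical arrows of `C`: the terms `v ^ l` (with no `u`) in the
coefficients of the differential, written as `U ^ 0`. -/
def vertical (C : FreeComplex (Fin n) Unit) : Matrix (Fin n) (Fin n) (Polynomial F2) :=
  C.diff.map (aeval fun t : Option Unit => t.elim 1 fun _ => 0)

/-- The grading constraints on a diagonal arrow from `x_j` to `U ^ k x_i`, where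
`k = (M(x_i) - M(x_j) + 1) / 2` is an integer: `1 ≤ k` and `A(x_i) - A(x_j) < k`. -/
def IsDiagonal (C : FreeComplex (Fin n) Unit) (p : Fin n × Fin n) : Prop :=
  Even (C.maslov p.1 - C.maslov p.2 + 1) ∧
  1 ≤ (C.maslov p.1 - C.maslov p.2 + 1) / 2 ∧
  C.alexander p.1 - C.alexander p.2 < (C.maslov p.1 - C.maslov p.2 + 1) / 2

instance (C : FreeComplex (Fin n) Unit) : DecidablePred (IsDiagonal C) := fun p => by
  unfold IsDiagonal; infer_instance

/-- The index set of the unknowns `a_{i,j}`. -/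
abbrev Unknown (C : FreeComplex (Fin n) Unit) : Type := {p : Fin n × Fin n // IsDiagonal C p}

/-- The placeholder matrix `D_var`, with entries `U ^ k a_{i,j}` at the positions that satisfy the
grading constraints, and zero elsewhere. -/
def Dvar (C : FreeComplex (Fin n) Unit) :
    Matrix (Fin n) (Fin n) (MvPolynomial (Unknown C) (Polynomial F2)) :=
  fun i j => if h : IsDiagonal C (i, j) then
      MvPolynomial.C (Polynomial.X ^ ((C.maslov i - C.maslov j + 1) / 2).toNat) *
        MvPolynomial.X ⟨(i, j), h⟩
    else 0

/-- The matrix `d_var = H + V + D_var`. -/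
def dvar (C : FreeComplex (Fin n) Unit) :
    Matrix (Fin n) (Fin n) (MvPolynomial (Unknown C) (Polynomial F2)) :=
  (horizontal C).map MvPolynomial.C + (vertical C).map MvPolynomial.C + Dvar C

/-- The matrix `d_var` with values in `𝔽` substituted for the unknowns. -/
def dvarAt (C : FreeComplex (Fin n) Unit) (a : Unknown C → F2) :
    Matrix (Fin n) (Fin n) (Polynomial F2) :=
  (dvar C).map (MvPolynomial.eval fun w => Polynomial.C (a w))

/-- The coefficient matrix of the linear system: the row `(k, l, r)` consists of the coefficients
of the unknowns in the coefficient of `U ^ r` of the entry `(k, l)` of `d_var ^ 2`. -/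
def systemMatrix (C : FreeComplex (Fin n) Unit) :
    Matrix (Fin n × Fin n × ℕ) (Unknown C) F2 :=
  fun e w => ((MvPolynomial.coeff (Finsupp.single w 1) ((dvar C ^ 2) e.1 e.2.1)).coeff e.2.2)

/-- The constant terms of the linear system. -/
def systemVector (C : FreeComplex (Fin n) Unit) : Fin n × Fin n × ℕ → F2 :=
  fun e => ((MvPolynomial.coeff 0 ((dvar C ^ 2) e.1 e.2.1)).coeff e.2.2)

end Placeholder

end

end KnotFloer

namespace KnotFloer

/-! ### Generators of a reduced complex and homology modulo `(u, v)` -/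

namespace FreeComplex

variable {ι τ : Type}

/-! Put δ = M - A. If `(i, j)` is admissible with exponent k, then δ(x_i) - δ(x_j) = 2k - 1 -
(A(x_i) - A(x_j)) ≥ k ≥ 1. Two composable diagonal arrows thus raise δ by at least 2. In a reduced
complex every generator survives in knot Floer homology
(`HomotopyEquivalent.nontrivial_hatHomology`), so thickness at most 2 forces equality: both
exponents are 1, the three generators share one Alexander grading, and their Maslov gradings are
consecutive. This contradicts the bound of two Maslov gradings (`IsDiagonal.not_comp`). Hence every
product occurring in `Dvar C ^ 2` vanishes. With B = H + V, what remains of the square is B² + B D +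
D B, of degree at most one in the unknowns, and comparing coefficients of powers of U gives the
linear system. -/

theorem mem_uvSub_iff (C : FreeComplex ι τ) (z : C.Chain) :
    z ∈ C.uvSub ↔ ∃ a b : C.Chain, z = C.u • a + C.v • b := by
  rw [uvSub, Ideal.span_insert, Submodule.sup_smul, Submodule.mem_sup]
  simp only [Submodule.ideal_span_singleton_smul, Submodule.mem_smul_pointwise_iff_exists,
    Submodule.mem_top, true_and]
  constructor
  · rintro ⟨_, ⟨a, rfl⟩, _, ⟨b, rfl⟩, rfl⟩
    exact ⟨a, b, rfl⟩
  · rintro ⟨a, b, rfl⟩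
    exact ⟨_, ⟨a, rfl⟩, _, ⟨b, rfl⟩, rfl⟩

/-- Over `𝔽[u, v]` a polynomial without constant term lies in the ideal `(u, v)`. -/
theorem mem_span_of_constantCoeff_eq_zero (C : FreeComplex ι Unit) {p : Coeff Unit}
    (hp : constantCoeff p = 0) : p ∈ Ideal.span {C.u, C.v} := by
  have h := (MvPolynomial.mem_ideal_span_X_image (R := F2) (x := p)
    (s := (Set.univ : Set (Option Unit)))).2 fun m hm => by
      by_contra! hcon
      have : m = 0 := by ext t; exact hcon t trivial
      rw [this, MvPolynomial.mem_support_iff] at hm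
      exact hm hp
  refine Ideal.span_mono ?_ h
  rintro _ ⟨t, -, rfl⟩
  rcases t with _ | t
  · right; rfl
  · left; rfl

/-- The map need not be linear over the full coefficient rings, which may differ; writing an element
as u a + v b uses only the actions of u and v. -/
theorem IsUVLinear.map_uvSub {ι' τ' : Type} [Fintype ι'] {C : FreeComplex ι τ}
    {C' : FreeComplex ι' τ'} {f : C.Chain →ₗ[F2] C'.Chain} (hf : C.IsUVLinear C' f)
    {z : C.Chain} (hz : z ∈ C.uvSub) : f z ∈ C'.uvSub := by
  obtain ⟨a, b, rfl⟩ := (C.mem_uvSub_iff z).1 hz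
  refine (C'.mem_uvSub_iff _).2 ⟨f a, f b, ?_⟩
  rw [map_add, (hf a).1, (hf b).2]

theorem constantCoeff_eq_zero_of_mem_uvSub {C : FreeComplex ι τ} {z : C.Chain}
    (hz : z ∈ C.uvSub) (i : ι) : constantCoeff (z i) = 0 := by
  obtain ⟨a, b, rfl⟩ := (C.mem_uvSub_iff z).1 hz
  simp [u, v]

theorem IsReducedComplex.d_mem_uvSub [Fintype ι] [DecidableEq ι] {C : FreeComplex ι Unit}
    (hC : C.IsReducedComplex) (z : C.Chain) : C.d z ∈ C.uvSub := by
  have hz : C.d z = ∑ i, ∑ j, (C.diff i j * z j) • (Pi.single i 1 : C.Chain) := by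
    funext k
    simp [d, Matrix.mulVec, dotProduct, Finset.sum_apply, Pi.single_apply]
  rw [hz]
  exact Submodule.sum_mem _ fun i _ => Submodule.sum_mem _ fun j _ =>
    Submodule.smul_mem_smul
      (Ideal.mul_mem_right _ _ (C.mem_span_of_constantCoeff_eq_zero (hC.reduced i j))) trivial

theorem single_mem_part [DecidableEq ι] (C : FreeComplex ι τ) (i : ι) :
    (Pi.single i 1 : C.Chain) ∈ C.part (C.maslov i) (C.alexander i) := by
  rw [part, Submodule.mem_pi]
  intro s _
  rw [mem_weightedHomogeneousSubmodule]
  by_cases h : s = i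
  · subst h
    simpa [← Prod.zero_eq_mk] using isWeightedHomogeneous_one F2 (varDegree τ)
  · simpa [Pi.single_apply, h] using isWeightedHomogeneous_zero F2 (varDegree τ) _

/-- Each generator of a reduced complex gives a nonzero class in the homology modulo `(u, v)` of
every complex that is homotopy equivalent to it. -/
theorem HomotopyEquivalent.nontrivial_hatHomology [Fintype ι] [DecidableEq ι] {ι' τ' : Type} [Fintype ι']
    {C : FreeComplex ι Unit} {C' : FreeComplex ι' τ'} (hC : C.IsReducedComplex)
    (h : C.HomotopyEquivalent C') (i : ι) :
    Nontrivial (C'.HatHomology (C.maslov i) (C.alexander i)) := by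
  obtain ⟨f, g, h, h', ⟨hf, hf0⟩, ⟨hg, -⟩, ⟨hh, -⟩, -, hfd, hgd, hgf, -⟩ := h
  set x : C.Chain := Pi.single i 1 with hx
  have hfx : f x ∈ C'.part (C.maslov i) (C.alexander i) := by
    simpa using hf0 _ _ x (C.single_mem_part i)
  have hcyc : C'.uvSub.mkQ (f x) ∈ C'.hatCycles (C.maslov i) (C.alexander i) := by
    refine ⟨⟨f x, hfx, rfl⟩, ?_⟩
    change C'.uvSub.mkQ (C'.d (f x)) = 0
    rw [← hfd]
    exact (Submodule.Quotient.mk_eq_zero _).2 (hf.map_uvSub (hC.d_mem_uvSub x))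
  refine Submodule.Quotient.nontrivial_iff.2 fun htop => ?_
  have hmem : (⟨_, hcyc⟩ : C'.hatCycles (C.maslov i) (C.alexander i)) ∈
      (C'.hatBoundaries (C.maslov i) (C.alexander i)).submoduleOf _ := htop ▸ trivial
  obtain ⟨_, ⟨z, -, rfl⟩, hz⟩ := hmem
  have hz' : C'.uvSub.mkQ (C'.d z) = C'.uvSub.mkQ (f x) := hz
  have hdiff : C'.d z - f x ∈ C'.uvSub := (Submodule.Quotient.eq _).1 hz'
  -- If `f x` bounds modulo `(u, v)`, so does `g (f x)`. As the differential of `C` vanishes there,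
  -- `g (f x)` is zero; but it is also homotopic, hence equal, to `x` modulo `(u, v)`.
  have h1 : C.d (g z) - g (f x) ∈ C.uvSub := by
    rw [← hgd, ← map_sub]
    exact hg.map_uvSub hdiff
  have h2 : g (f x) ∈ C.uvSub := by
    simpa using Submodule.sub_mem _ (hC.d_mem_uvSub (g z)) h1
  have h3 : g (f x) - x ∈ C.uvSub := by
    rw [hgf]
    exact Submodule.add_mem _ (hC.d_mem_uvSub _) (hh.map_uvSub (hC.d_mem_uvSub _))
  have h4 : x ∈ C.uvSub := by simpa using Submodule.sub_mem _ h2 h3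
  simpa [hx] using constantCoeff_eq_zero_of_mem_uvSub h4 i

end FreeComplex

/-! ### Gradings of diagonal arrows -/

theorem KnotGrid.natAbs_le_of_thickness_le {N : ℕ} [NeZero N] {G : KnotGrid N} {t : ℕ}
    (h : G.thickness ≤ t) {p q : ℤ × ℤ} (hp : p ∈ G.hfkSupport) (hq : q ∈ G.hfkSupport) :
    ((p.1 - p.2) - (q.1 - q.2)).natAbs ≤ t := by
  simp only [thickness, iSup_le_iff] at h
  exact_mod_cast h p hp q hq

/-- Two diagonal arrows are never composable. -/
theorem IsDiagonal.not_comp {N : ℕ} [NeZero N] {G : KnotGrid N} (hth : G.thickness ≤ 2)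
    (hsupp : ∀ a : ℤ, {m : ℤ | Nontrivial (G.HFK m a)}.encard ≤ 2)
    {n : ℕ} {C : FreeComplex (Fin n) Unit} (hC : G.IsReducedRepresentative C)
    {i j k : Fin n} (hij : IsDiagonal C (i, j)) : ¬ IsDiagonal C (j, k) := by
  intro hjk
  have hne : ∀ s, Nontrivial (G.HFK (C.maslov s) (C.alexander s)) := fun s =>
    hC.2.nontrivial_hatHomology hC.1 s
  have hik := KnotGrid.natAbs_le_of_thickness_le (G := G) (t := 2) (by exact_mod_cast hth)
    (p := (C.maslov i, C.alexander i)) (q := (C.maslov k, C.alexander k)) (hne i) (hne k)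
  obtain ⟨⟨s, hs⟩, h1, h2⟩ := hij
  obtain ⟨⟨t, ht⟩, h3, h4⟩ := hjk
  simp only at hs h1 h2 ht h3 h4 hik
  -- δ rises by at least `s` and then `t`, both at least 1, and by at most 2 in total, so `s = t =
  -- 1` and neither arrow changes the Alexander grading.
  have hMij : C.maslov i = C.maslov j + 1 := by omega
  have hMjk : C.maslov j = C.maslov k + 1 := by omega
  have hAij : C.alexander i = C.alexander j := by omega
  have hAjk : C.alexander k = C.alexander j := by omega
  have hsub : ({C.maslov i, C.maslov j, C.maslov k} : Set ℤ) ⊆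
      {m : ℤ | Nontrivial (G.HFK m (C.alexander j))} := by
    rintro m (rfl | rfl | rfl)
    · exact hAij ▸ hne i
    · exact hne j
    · exact hAjk ▸ hne k
  have hcard := (Set.encard_le_encard hsub).trans (hsupp (C.alexander j))
  rw [Set.encard_eq_three.2 ⟨C.maslov i, C.maslov j, C.maslov k, by omega, by omega, by omega,
    rfl⟩] at hcard
  exact absurd hcard (by decide)

/-! ### Degree in the unknowns and the linear system -/

/-- A polynomial of degree at most one is the sum of its constant and its linear terms. -/
theorem eval_eq_of_totalDegree_le_one {σ R : Type*} [Fintype σ] [CommRing R]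
    {p : MvPolynomial σ R} (hp : p.totalDegree ≤ 1) (x : σ → R) :
    eval x p = coeff 0 p + ∑ w, coeff (Finsupp.single w 1) p * x w := by
  classical
  have hsub : p.support ⊆
      insert 0 (Finset.univ.image fun w : σ => Finsupp.single w 1) := by
    intro m hm
    have hdeg : m.degree ≤ 1 := (le_totalDegree hm).trans hp
    rw [Finset.mem_insert, or_iff_not_imp_left]
    intro hm0
    obtain ⟨w, hw⟩ := Finsupp.ne_iff.1 hm0
    have hle : Finsupp.single w 1 ≤ m := Finsupp.single_le_iff.2 (Nat.one_le_iff_ne_zero.2 hw)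
    obtain ⟨m', rfl⟩ := exists_add_of_le hle
    have hm' : m'.degree = 0 := by
      rw [map_add, Finsupp.degree_single] at hdeg
      omega
    rw [(Finsupp.degree_eq_zero_iff m').1 hm', add_zero]
    exact Finset.mem_image_of_mem _ (Finset.mem_univ w)
  rw [eval_eq, Finset.sum_subset hsub fun m _ hm => by rw [notMem_support_iff.1 hm, zero_mul],
    Finset.sum_insert (by simp [eq_comm]),
    Finset.sum_image fun a _ b _ h => Finsupp.single_left_injective one_ne_zero h]
  congr 1
  · simp
  · refine Finset.sum_congr rfl fun w _ => ?_
    rw [Finset.prod_eq_single w (fun b _ hb => by simp [hb.symm])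
      (by simp)]
    simp

variable {n : ℕ}

theorem totalDegree_Dvar_le_one (C : FreeComplex (Fin n) Unit) (i j : Fin n) :
    (Dvar C i j).totalDegree ≤ 1 := by
  unfold Dvar
  split_ifs
  · refine (totalDegree_mul _ _).trans ?_
    rw [totalDegree_C, totalDegree_X]
  · simp

theorem totalDegree_dvar_sq_le_one {C : FreeComplex (Fin n) Unit} (hD : Dvar C ^ 2 = 0)
    (k l : Fin n) : ((dvar C ^ 2) k l).totalDegree ≤ 1 := by
  set B : Matrix (Fin n) (Fin n) (Polynomial F2) := horizontal C + vertical C with hB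
  have hsplit : dvar C ^ 2 =
      (B * B).map MvPolynomial.C + B.map MvPolynomial.C * Dvar C
        + Dvar C * B.map MvPolynomial.C := by
    have : dvar C = B.map MvPolynomial.C + Dvar C := by
      rw [dvar, hB, Matrix.map_add _ (map_add _)]
    rw [this, Matrix.map_mul, pow_two, Matrix.add_mul, Matrix.mul_add, Matrix.mul_add,
      ← pow_two (Dvar C), hD, add_zero, add_assoc]
  rw [hsplit, Matrix.add_apply, Matrix.add_apply]
  refine (totalDegree_add _ _).trans (max_le ((totalDegree_add _ _).trans (max_le ?_ ?_)) ?_)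
  · simp
  · refine totalDegree_finsetSum_le fun s _ => (totalDegree_mul _ _).trans ?_
    simpa using totalDegree_Dvar_le_one C s l
  · refine totalDegree_finsetSum_le fun s _ => (totalDegree_mul _ _).trans ?_
    simpa using totalDegree_Dvar_le_one C k s

/-- The substituted values are constant in U, so taking the coefficient of U^r commutes with the
linear combination. -/
theorem coeff_dvarAt_sq {C : FreeComplex (Fin n) Unit}
    (hdeg : ∀ k l : Fin n, ((dvar C ^ 2) k l).totalDegree ≤ 1) (a : Unknown C → F2)
    (k l : Fin n) (r : ℕ) :
    ((dvarAt C a ^ 2) k l).coeff r =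
      systemVector C (k, l, r) + (systemMatrix C).mulVec a (k, l, r) := by
  have : dvarAt C a ^ 2 = (dvar C ^ 2).map (eval fun w => Polynomial.C (a w)) := by
    rw [dvarAt, pow_two, pow_two, Matrix.map_mul]
  rw [this, Matrix.map_apply, eval_eq_of_totalDegree_le_one (hdeg k l), Polynomial.coeff_add,
    Polynomial.finsetSum_coeff]
  simp only [Polynomial.coeff_mul_C]
  rfl

end KnotFloer

open KnotFloer in
theorem mainTheorem6 {N : ℕ} [NeZero N] (G : KnotFloer.KnotGrid N)
    (hth : G.thickness ≤ 2)
    (hsupp : ∀ a : ℤ, {m : ℤ | Nontrivial (G.HFK m a)}.encard ≤ 2)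
    {n : ℕ} (C : KnotFloer.FreeComplex (Fin n) Unit) (hC : G.IsReducedRepresentative C) :
    KnotFloer.Dvar C ^ 2 = 0 ∧
    (∀ k l : Fin n, ((KnotFloer.dvar C ^ 2) k l).totalDegree ≤ 1) ∧
    (∀ a : KnotFloer.Unknown C → ZMod 2,
      KnotFloer.dvarAt C a ^ 2 = 0 ↔
        (KnotFloer.systemMatrix C).mulVec a = KnotFloer.systemVector C) := by
  have hD : Dvar C ^ 2 = 0 := by
    ext1 i j
    rw [pow_two, Matrix.mul_apply]
    refine Finset.sum_eq_zero fun k _ => ?_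
    by_cases hik : IsDiagonal C (i, k)
    · have hkj : ¬ IsDiagonal C (k, j) := hik.not_comp hth hsupp hC
      simp [Dvar, hkj]
    · simp [Dvar, hik]
  have hdeg := totalDegree_dvar_sq_le_one hD
  refine ⟨hD, hdeg, fun a => ⟨fun h => ?_, fun h => ?_⟩⟩
  · funext ⟨k, l, r⟩
    have hr := coeff_dvarAt_sq hdeg a k l r
    rw [h, Matrix.zero_apply, Polynomial.coeff_zero] at hr
    -- Characteristic 2 makes b + Aa = 0 the same as Aa = b.
    exact (CharTwo.add_eq_zero.1 hr.symm).symm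
  · ext k l r
    rw [coeff_dvarAt_sq hdeg, h, Matrix.zero_apply, Polynomial.coeff_zero]
    exact CharTwo.add_self_eq_zero _
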